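/- Let $n \ge 0$ be an integer and write $[x]_2 \in \{0,1\}$ for the parity of $x$. Let $G_n$ be the graph with vertex set $$\mathtt V_n = \{(x_1,x_2)\in\mathbb Z^2 : 0 \le x_1 \le 2n,\ x_1 \le x_2 \le 2n+1\},$$ from which the point $(2n,2n+1)$ is removed when $n$ is odd, and with the following edges between vertices of $\mathtt V_n$: $\{(x_1,x_2),(x_1+1,x_2)\}$ for $0\le x_1\le 2n-1$, $x_1\le x_2\le 2n+1$ and $x_1+x_2$ odd; $\{(x_1,x_2),(x_1,x_2+1)\}$ for $0\le x_1\le 2n-[n]_2$ and $x_1\le x_2\le 2n$; and $\{(x_1,x_1),(x_1+1,x_1+1)\}$ for $0\le x_1\le 2n-1$. (The perfect matchings of $G_n$ encode totally symmetric self-complementary plane partitions.) Let $\mathbf b=(2n,2n+1-[n]_2)$. Let $Z_n$ be the number of perfect matchings of $G_n$ and, for $U\subseteq \mathtt V_n$, let $Z_n^{U}$ be the number of perfect matchings of the subgraph of $G_n$ induced on $\mathtt V_n\setminus U$. Let $K_n$ be the skew-symmetric Kasteleyn matrix indexed by $\mathtt V_n$, with entries $K_n(x,y)=k_n(x,y)-k_n(y,x)$,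 where $k_n(x,y)=1$ if - $x_1+x_2$ is even, $x_2=y_2$ and $x_1-y_1=1$, or - $x_1+x_2$ is even, $x_1=y_1$ and $|x_2-y_2|=1$, or - $x_1=x_2$ and $y_1=y_2=x_1-1$, and $k_n(x,y)=0$ otherwise. Then $K_n$ is invertible, $Z_n\neq 0$, and for all $0\le j\le 2n$ the quantity $g_n^{\mathbf b}(j)=|K_n^{-1}((j,j),\mathbf b)|$ satisfies $$g_n^{\mathbf b}(j)=(-1)^{j+1}K_n^{-1}((j,j),\mathbf b)=\frac{Z_n^{\{(j,j),\mathbf b\}}}{Z_n}.$$ Moreover $$\sum_{j=0}^{2n} g_n^{\mathbf b}(j)=\begin{cases} n+1 & n \text{ even},\\ n+\tfrac12 & n\text{ odd}.\end{cases}$$ -/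

import Mathlib

namespace TSSCPP

/-- The vertex set `V_n`: all `(x₁, x₂)` with `0 ≤ x₁ ≤ 2n` and `x₁ ≤ x₂ ≤ 2n + 1`, except that
`(2n, 2n + 1)` is left out when `n` is odd. -/
def vertexSet (n : ℕ) : Finset (ℕ × ℕ) :=
  (Finset.range (2 * n + 1) ×ˢ Finset.range (2 * n + 2)).filter
    (fun x => x.1 ≤ x.2 ∧ ¬ (Odd n ∧ x = (2 * n, 2 * n + 1)))

/-- The type of vertices of `G_n`. -/
abbrev Vertex (n : ℕ) : Type := {x : ℕ × ℕ // x ∈ vertexSet n}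

theorem diag_mem (n : ℕ) (j : Fin (2 * n + 1)) : ((j : ℕ), (j : ℕ)) ∈ vertexSet n := by
  have := j.isLt
  simp [vertexSet, Prod.ext_iff]
  omega

theorem b_mem (n : ℕ) : (2 * n, 2 * n + 1 - n % 2) ∈ vertexSet n := by
  simp [vertexSet, Prod.ext_iff, Nat.odd_iff]
  omega

/-- The diagonal vertex `(j, j)`, for `0 ≤ j ≤ 2n`. -/
def diag (n : ℕ) (j : Fin (2 * n + 1)) : Vertex n := ⟨((j : ℕ), (j : ℕ)), diag_mem n j⟩

/-- The distinguished vertex `b = (2n, 2n + 1 - (n mod 2))`. -/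
def b (n : ℕ) : Vertex n := ⟨(2 * n, 2 * n + 1 - n % 2), b_mem n⟩

/-- The list of edges `(x, y)` of `G_n`, each one written in one of its two directions:
* `((x₁, x₂), (x₁ + 1, x₂))` with `x₁ ≤ 2n - 1`, `x₁ ≤ x₂ ≤ 2n + 1`, and `x₁ + x₂` odd;
* `((x₁, x₂), (x₁, x₂ + 1))` with `x₁ ≤ 2n - (n mod 2)` and `x₁ ≤ x₂ ≤ 2n`;
* `((x₁, x₁), (x₁ + 1, x₁ + 1))` with `x₁ ≤ 2n - 1`. -/
def edgeRel (n : ℕ) (x y : ℕ × ℕ) : Prop :=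
  (x.1 < 2 * n ∧ x.1 ≤ x.2 ∧ x.2 ≤ 2 * n + 1 ∧ (x.1 + x.2) % 2 = 1 ∧ y = (x.1 + 1, x.2)) ∨
  (x.1 + n % 2 ≤ 2 * n ∧ x.1 ≤ x.2 ∧ x.2 ≤ 2 * n ∧ y = (x.1, x.2 + 1)) ∨
  (x.1 < 2 * n ∧ x.2 = x.1 ∧ y = (x.1 + 1, x.1 + 1))

/-- The graph `G_n` whose perfect matchings correspond to TSSCPPs. -/
def G (n : ℕ) : SimpleGraph (Vertex n) :=
  SimpleGraph.fromRel (fun x y => edgeRel n x.1 y.1)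

/-- The number of dimer configurations (perfect matchings) of a graph. -/
noncomputable def numDimers {V : Type} (H : SimpleGraph V) : ℕ :=
  Nat.card {M : H.Subgraph // M.IsPerfectMatching}

/-- `Z_n`, the number of dimer configurations of `G_n`. -/
noncomputable def Z (n : ℕ) : ℕ := numDimers (G n)

/-- `Z_n^U`, the number of dimer configurations of the subgraph of `G_n` induced on the vertices
that are not in `U`. -/
noncomputable def ZRemove (n : ℕ) (U : Set (Vertex n)) : ℕ := numDimers ((G n).induce Uᶜ)

/-- The oriented adjacency function `k_n` (`1` for an arrow from `x` to `y`, otherwise `0`). -/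
def k (x y : ℕ × ℕ) : ℚ :=
  if (x.1 + x.2) % 2 = 0 ∧ x.2 = y.2 ∧ x.1 = y.1 + 1 then 1
  else if (x.1 + x.2) % 2 = 0 ∧ (y.2 = x.2 + 1 ∨ x.2 = y.2 + 1) ∧ x.1 = y.1 then 1
  else if x.1 = x.2 ∧ y.1 = y.2 ∧ x.1 = y.1 + 1 then 1
  else 0

/-- The skew-symmetric Kasteleyn matrix `K_n` of `G_n`. -/
def K (n : ℕ) : Matrix (Vertex n) (Vertex n) ℚ :=
  Matrix.of (fun x y => k x.1 y.1 - k y.1 x.1)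

/-- `g_n^b(j) = |K_n⁻¹((j, j), b)|`, for `0 ≤ j ≤ 2n`. -/
noncomputable def g (n : ℕ) (j : Fin (2 * n + 1)) : ℚ := |(K n)⁻¹ (diag n j) (b n)|

end TSSCPP

/-!
The proof identifies signed Pfaffians with numbers of perfect matchings, and then solves part of
the linear system `K v = e_b` by pairing it with one explicit vector.

*Pfaffians.* For an antisymmetric weight on a linearly ordered type, Wick contraction gives a
linear functional on the exterior algebra (`Pfaffian.functional`), and its value on the ordered
product of the elements of a finite set is the Pfaffian of that set. Expansion along the least
element (`Pfaffian.pf_insert`) and the adjugate formula (`Pfaffian.sum_mul_pf_erase`) follow from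
the fact that contractions are antiderivations of the exterior algebra.

*Signs.* Conjugating by a diagonal sign matrix (`gauge`) turns the Kasteleyn matrix into the
antisymmetric matrix with entry `1` on every edge directed up, to the right, or along the diagonal,
that is, from the smaller to the larger endpoint in lexicographic order. For this weight all
perfect matchings contribute with the same sign to the Pfaffian. This is proved by removing the
least vertex over and over (`Site.pf_eq_matchCount`): if the current column has `s` vertices left
and `t` vertices of the next column have been used, then the sign is `(-1) ^ (s * t)`. Up to an
explicit sign, the Pfaffian is thus `Z_n` for the whole vertex set, and `Z_n^{(j,j),b}` when `b`,
the last vertex, and `(j, j)`, the first vertex of its column, are left out. As `G_n` has a perfect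
matching (`Z_ne_zero`), the adjugate formula inverts `K_n` and expresses the column of `b` by dimer
counts.

*The sum.* Let `v` be the column of `b` in the inverse matrix. Pair `K v` with the vector whose
entries are `(-1) ^ c * (c + 1)` at `(c, c)`, `(-1) ^ c` at `(c, c + 2)`, and `0` elsewhere.
All entries of `v` off the diagonal cancel, but the one at `(2n, 2n + 1)`, which is absent or zero.
What is left is
`2 * ∑ c, (-1) ^ (c + 1) * v (c, c)` with a boundary term at `c = 2n` (`sum_rows_telescope`).
The value `v (2n, 2n)` is known: it is `-1` for even `n`, by the row of `b`, and `0` for odd `n`,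
where `b = (2n, 2n)`.
-/

/-! ### The Pfaffian as a functional on the exterior algebra -/

namespace Pfaffian

open CliffordAlgebra

section Functional

variable {R M : Type*} [CommRing R] [AddCommGroup M] [Module R M]

theorem toQuadraticMap_neg_eq {B : LinearMap.BilinForm R M} (hB : B.IsAlt) :
    (-B).toQuadraticMap = (0 : QuadraticForm R M) - 0 := by
  ext v
  simp [hB v]

/-- The Pfaffian functional of an alternating form `B`: the scalar part after all Wick contractions
with `B`. The form enters `changeForm` with a minus sign, so that `m₁ ∧ m₂` is sent to `B m₁ m₂`. -/
noncomputable def functional (B : LinearMap.BilinForm R M) (hB : B.IsAlt) :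
    ExteriorAlgebra R M →ₗ[R] R :=
  ExteriorAlgebra.algebraMapInv.toLinearMap ∘ₗ changeForm (toQuadraticMap_neg_eq hB)

theorem functional_one {B : LinearMap.BilinForm R M} (hB : B.IsAlt) : functional B hB 1 = 1 := by
  have : changeForm (toQuadraticMap_neg_eq hB) 1 = 1 := changeForm_one _
  simp only [functional, LinearMap.comp_apply]
  erw [this]
  exact map_one ExteriorAlgebra.algebraMapInv

/-- Wick's theorem for one vector: it is contracted with the rest of the product. -/
theorem functional_ι_mul {B : LinearMap.BilinForm R M} (hB : B.IsAlt) (m : M)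
    (w : ExteriorAlgebra R M) :
    functional B hB (ExteriorAlgebra.ι R m * w) = functional B hB (contractLeft (B m) w) := by
  have h1 := changeForm_ι_mul (toQuadraticMap_neg_eq hB) m w
  have h2 := changeForm_contractLeft (toQuadraticMap_neg_eq hB) (B m) w
  simp only [functional, LinearMap.comp_apply]
  erw [h1, h2, map_sub]
  erw [map_mul ExteriorAlgebra.algebraMapInv]
  have h3 : ExteriorAlgebra.algebraMapInv (ExteriorAlgebra.ι R m) = 0 := by
    simp [ExteriorAlgebra.algebraMapInv]
  erw [h3]
  simp only [zero_mul, zero_sub, LinearMap.neg_apply, map_neg, neg_neg]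

end Functional

/-! ### Ordered monomials and contractions -/

section Monomial

variable {α : Type*} [LinearOrder α]

/-- The generator of the exterior algebra attached to `x`. -/
noncomputable def gen (x : α) : ExteriorAlgebra ℚ (α →₀ ℚ) :=
  ExteriorAlgebra.ι ℚ (Finsupp.single x 1)

/-- The product of the generators attached to the elements of `S`, in increasing order. -/
noncomputable def monomial (S : Finset α) : ExteriorAlgebra ℚ (α →₀ ℚ) :=
  ((S.sort (· ≤ ·)).map gen).prod

theorem monomial_empty : monomial (∅ : Finset α) = 1 := by
  simp [monomial]

theorem monomial_insert {S : Finset α} {x : α} (hx : ∀ y ∈ S, x < y) :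
    monomial (insert x S) = gen x * monomial S := by
  rw [monomial, Finset.sort_insert _ (fun y hy => (hx y hy).le) (fun h => lt_irrefl _ (hx x h))]
  simp [monomial]

theorem contractLeft_monomial (d : Module.Dual ℚ (α →₀ ℚ)) (S : Finset α) :
    contractLeft (Q := (0 : QuadraticForm ℚ (α →₀ ℚ))) d (monomial S) =
      ∑ y ∈ S, ((-1) ^ (S.filter (· < y)).card * d (Finsupp.single y 1)) •
        monomial (S.erase y) := by
  induction S using Finset.induction_on_min with
  | empty =>
    rw [monomial_empty, Finset.sum_empty]
    exact contractLeft_one _ _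
  | insert a s ha ih =>
    have hna : a ∉ s := fun h => lt_irrefl _ (ha a h)
    rw [monomial_insert ha, Finset.sum_insert hna]
    refine (contractLeft_ι_mul (Q := (0 : QuadraticForm ℚ (α →₀ ℚ))) d _ _).trans ?_
    rw [ih]
    have e1 : (insert a s).filter (· < a) = ∅ := by
      rw [Finset.filter_eq_empty_iff]
      intro y hy
      rcases Finset.mem_insert.1 hy with rfl | hy
      · exact lt_irrefl _
      · exact (ha y hy).not_gt
    rw [e1, Finset.erase_insert hna, sub_eq_add_neg]
    congr 1
    · simp
    · change -(gen a * _) = _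
      rw [Finset.mul_sum, ← Finset.sum_neg_distrib]
      refine Finset.sum_congr rfl fun y hy => ?_
      have hay : a ≠ y := (ha y hy).ne
      rw [Finset.filter_insert, if_pos (ha y hy), Finset.card_insert_of_notMem (by simp [hna]),
        Finset.erase_insert_of_ne hay, monomial_insert
          (fun z hz => ha z (Finset.mem_of_mem_erase hz)), mul_smul_comm, pow_succ]
      simp

theorem gen_mul_monomial {S : Finset α} {x : α} (hx : x ∈ S) : gen x * monomial S = 0 := by
  induction S using Finset.induction_on_min with
  | empty => simp at hx
  | insert a s ha ih =>
    rw [monomial_insert ha, ← mul_assoc]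
    rcases Finset.mem_insert.1 hx with rfl | hxs
    · simp [gen]
    · have : gen x * gen a = - (gen a * gen x) := by
        rw [eq_neg_iff_add_eq_zero]
        exact ExteriorAlgebra.ι_add_mul_swap _ _
      rw [this, neg_mul, mul_assoc, ih hxs, mul_zero, neg_zero]

/-- Contracting the identity `gen x * monomial S = 0` with the coordinate of `x` gives the value
for `x = b`. -/
theorem gen_mul_monomial_erase {S : Finset α} {x b : α} (hx : x ∈ S) (hb : b ∈ S) :
    gen x * monomial (S.erase b) =
      if x = b then (-1 : ℚ) ^ (S.filter (· < b)).card • monomial S else 0 := by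
  split_ifs with h
  · subst h
    have h0 := congrArg (contractLeft (Q := (0 : QuadraticForm ℚ (α →₀ ℚ)))
      (Finsupp.lapply x)) (gen_mul_monomial hx)
    have h1 := contractLeft_ι_mul (Q := (0 : QuadraticForm ℚ (α →₀ ℚ)))
      (Finsupp.lapply x) (Finsupp.single x 1) (monomial S)
    rw [map_zero] at h0
    have h2 := h1.symm.trans h0
    rw [contractLeft_monomial, Finset.sum_eq_single x] at h2
    · simp only [Finsupp.lapply_apply, Finsupp.single_eq_same, one_smul, mul_one] at h2
      change monomial S - gen x * _ = 0 at h2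
      rw [sub_eq_zero, mul_smul_comm] at h2
      conv_rhs => rw [h2]
      rw [smul_smul, ← mul_pow]
      simp
    · intro y _ hy
      simp [hy]
    · exact fun h => absurd hx h
  · exact gen_mul_monomial (Finset.mem_erase.2 ⟨h, hx⟩)

end Monomial

/-! ### Pfaffians of finite sets -/

section Pf

variable {α : Type*}

/-- The bilinear form on finitely supported functions with matrix `A`. -/
noncomputable def form (A : α → α → ℚ) : LinearMap.BilinForm ℚ (α →₀ ℚ) :=
  Finsupp.lift _ ℚ α (fun x => Finsupp.lift ℚ ℚ α (A x))

theorem form_single (A : α → α → ℚ) (x y : α) :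
    form A (Finsupp.single x 1) (Finsupp.single y 1) = A x y := by
  simp [form]

theorem form_isAlt {A : α → α → ℚ} (hA : ∀ x y, A x y = -A y x) : (form A).IsAlt := by
  have h : form A = -(form A).flip := by
    ext x y
    simpa [form] using hA x y
  intro v
  have hv : form A v v = -form A v v := LinearMap.congr_fun₂ h v v
  linarith

variable [LinearOrder α] {A : α → α → ℚ} (hA : ∀ x y, A x y = -A y x)

/-- The Pfaffian of the antisymmetric matrix `A` restricted to `S`, with the order of the type. -/
noncomputable def pf (S : Finset α) : ℚ := functional (form A) (form_isAlt hA) (monomial S)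

theorem pf_empty : pf hA ∅ = 1 := by
  rw [pf, monomial_empty, functional_one]

theorem functional_gen_mul (x : α) (S : Finset α) :
    functional (form A) (form_isAlt hA) (gen x * monomial S) =
      ∑ y ∈ S, (-1) ^ (S.filter (· < y)).card * A x y * pf hA (S.erase y) := by
  rw [gen, functional_ι_mul]
  have h := congrArg (functional (form A) (form_isAlt hA))
    (contractLeft_monomial (form A (Finsupp.single x 1)) S)
  refine h.trans ?_
  simp only [map_sum, map_smul, form_single, smul_eq_mul, pf]

/-- Expansion of the Pfaffian along the least element. -/
theorem pf_insert {S : Finset α} {x : α} (hx : ∀ y ∈ S, x < y) :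
    pf hA (insert x S) =
      ∑ y ∈ S, (-1) ^ (S.filter (· < y)).card * A x y * pf hA (S.erase y) := by
  rw [pf, monomial_insert hx, functional_gen_mul]

/-- The adjugate formula: the signed Pfaffians with two elements left out are, up to the factor
`pf hA S`, the entries of the inverse of `A` on `S`. -/
theorem sum_mul_pf_erase {S : Finset α} {x b : α} (hx : x ∈ S) (hb : b ∈ S) :
    ∑ y ∈ S.erase b, A x y * ((-1) ^ ((S.erase b).filter (· < y)).card *
      pf hA ((S.erase b).erase y)) =
      if x = b then (-1 : ℚ) ^ (S.filter (· < b)).card * pf hA S else 0 := by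
  have h := congrArg (functional (form A) (form_isAlt hA)) (gen_mul_monomial_erase hx hb)
  rw [functional_gen_mul hA] at h
  refine (Finset.sum_congr rfl fun y _ => ?_).trans (h.trans ?_)
  · ring
  · split_ifs
    · rw [map_smul, smul_eq_mul, pf]
    · exact map_zero _

end Pf

end Pfaffian

namespace TSSCPP

/-! ### Counting perfect matchings -/

section Matchings

variable {α : Type*}

/-- `f` encodes a perfect matching of the subgraph of `H` induced on `S`: it sends every element of
`S` to its partner, and fixes all other points, so that it is determined by the matching. -/
def IsMatchingOn (H : SimpleGraph α) (S : Finset α) (f : α → α) : Prop :=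
  (∀ x ∈ S, f x ∈ S ∧ f (f x) = x ∧ H.Adj x (f x)) ∧ ∀ x ∉ S, f x = x

/-- The number of perfect matchings of the subgraph of `H` induced on `S`. -/
noncomputable def matchCount (H : SimpleGraph α) (S : Finset α) : ℕ :=
  Nat.card {f : α → α // IsMatchingOn H S f}

instance finite_isMatchingOn (H : SimpleGraph α) (S : Finset α) :
    Finite {f : α → α // IsMatchingOn H S f} := by
  refine Finite.of_injective
    (fun f => fun x : S => (⟨f.1 x, (f.2.1 x x.2).1⟩ : S)) fun f g hfg => ?_
  ext x
  by_cases hx : x ∈ S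
  · simpa using congrFun hfg ⟨x, hx⟩
  · rw [f.2.2 x hx, g.2.2 x hx]

theorem matchCount_empty (H : SimpleGraph α) : matchCount H ∅ = 1 := by
  rw [matchCount, Nat.card_eq_one_iff_unique]
  refine ⟨⟨fun f g => ?_⟩, ⟨⟨id, by simp [IsMatchingOn]⟩⟩⟩
  ext x
  rw [f.2.2 x (by simp), g.2.2 x (by simp)]

theorem matchCount_ne_zero {H : SimpleGraph α} {S : Finset α} {f : α → α}
    (hf : ∀ x ∈ S, f x ∈ S ∧ f (f x) = x ∧ H.Adj x (f x)) : matchCount H S ≠ 0 := by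
  classical
  rw [matchCount, Nat.card_ne_zero]
  refine ⟨⟨⟨fun x => if x ∈ S then f x else x, fun x hx => ?_, fun x hx => by simp [hx]⟩⟩,
    inferInstance⟩
  obtain ⟨h1, h2, h3⟩ := hf x hx
  simp [hx, h1, h2, h3]

variable [DecidableEq α]

/-- The matchings of `insert x T` with `x` matched to `y` correspond to those of `T.erase y`: the
pair is replaced by two fixed points. -/
theorem card_isMatchingOn_fiber {H : SimpleGraph α} {T : Finset α} {x y : α} (hx : x ∉ T)
    (hy : y ∈ T) (hxy : H.Adj x y) :
    Nat.card {f : {f : α → α // IsMatchingOn H (insert x T) f} // f.1 x = y} =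
      matchCount H (T.erase y) := by
  have hne : x ≠ y := fun h => hx (h ▸ hy)
  refine Nat.card_congr
    { toFun := fun f => ⟨Function.update (Function.update f.1.1 x x) y y, ?_, ?_⟩
      invFun := fun g => ⟨⟨Function.update (Function.update g.1 x y) y x, ?_, ?_⟩, ?_⟩
      left_inv := ?_
      right_inv := ?_ }
  · obtain ⟨⟨f, hf⟩, hfx⟩ := f
    intro z hz
    simp only at hfx ⊢
    obtain ⟨hzy, hzT⟩ := Finset.mem_erase.1 hz
    have hzx : z ≠ x := fun h => hx (h ▸ hzT)
    obtain ⟨h1, h2, h3⟩ := hf.1 z (Finset.mem_insert_of_mem hzT)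
    have h4 := (hf.1 x (Finset.mem_insert_self _ _)).2.1
    have h5 : f z ≠ x := fun h => hzy (by rw [← h2, h, hfx])
    have h6 : f z ≠ y := fun h => hzx (by rw [← h2, h, ← hfx, h4])
    have h7 : f z ∈ T := (Finset.mem_insert.1 h1).resolve_left h5
    simp [Function.update_of_ne, hzx, hzy, h5, h6, h2, h3, h7]
  · obtain ⟨⟨f, hf⟩, hfx⟩ := f
    intro z hz
    simp only at hfx ⊢
    by_cases hzy : z = y
    · simp [hzy]
    by_cases hzx : z = x
    · simp [hzx, hne]
    rw [Function.update_of_ne hzy, Function.update_of_ne hzx]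
    refine hf.2 z fun h => hz ?_
    exact Finset.mem_erase.2 ⟨hzy, (Finset.mem_insert.1 h).resolve_left hzx⟩
  · obtain ⟨g, hg⟩ := g
    intro z hz
    simp only
    by_cases hzy : z = y
    · subst hzy
      simp [hne, hxy.symm]
    by_cases hzx : z = x
    · subst hzx
      simp [hne, hxy, hy]
    have hzT := (Finset.mem_insert.1 hz).resolve_left hzx
    obtain ⟨h1, h2, h3⟩ := hg.1 z (Finset.mem_erase.2 ⟨hzy, hzT⟩)
    obtain ⟨h4, h5⟩ := Finset.mem_erase.1 h1
    have h6 : g z ≠ x := fun h => hx (h ▸ h5)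
    simp [Function.update_of_ne, hzx, hzy, h4, h6, h2, h3, h5]
  · obtain ⟨g, hg⟩ := g
    intro z hz
    have hzx : z ≠ x := fun h => hz (h ▸ Finset.mem_insert_self _ _)
    have hzT : z ∉ T := fun h => hz (Finset.mem_insert_of_mem h)
    have hzy : z ≠ y := fun h => hzT (h ▸ hy)
    simp only
    rw [Function.update_of_ne hzy, Function.update_of_ne hzx]
    exact hg.2 z fun h => hzT (Finset.mem_of_mem_erase h)
  · simp [hne]
  · rintro ⟨⟨f, hf⟩, hfx⟩
    simp only at hfx
    have h4 := (hf.1 x (Finset.mem_insert_self _ _)).2.1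
    rw [hfx] at h4
    ext z
    by_cases hzy : z = y
    · simp [hzy, h4]
    by_cases hzx : z = x
    · simp [hzx, hne, hfx]
    simp [hzx, hzy]
  · rintro ⟨g, hg⟩
    ext z
    by_cases hzy : z = y
    · simpa [hzy] using (hg.2 y (by simp)).symm
    by_cases hzx : z = x
    · simpa [hzx, hne] using (hg.2 x (by simp [hx])).symm
    simp [hzx, hzy]

open Classical in
/-- Expansion of the number of matchings along one vertex. -/
theorem matchCount_insert (H : SimpleGraph α) {T : Finset α} {x : α} (hx : x ∉ T) :
    matchCount H (insert x T) =
      ∑ y ∈ T, if H.Adj x y then matchCount H (T.erase y) else 0 := by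
  have hmem : ∀ f : {f : α → α // IsMatchingOn H (insert x T) f}, f.1 x ∈ T ∧ H.Adj x (f.1 x) := by
    rintro ⟨f, hf⟩
    obtain ⟨h1, -, h3⟩ := hf.1 x (Finset.mem_insert_self _ _)
    exact ⟨(Finset.mem_insert.1 h1).resolve_left h3.ne', h3⟩
  let φ : {f : α → α // IsMatchingOn H (insert x T) f} → T := fun f => ⟨f.1 x, (hmem f).1⟩
  rw [matchCount, ← Nat.card_congr (Equiv.sigmaFiberEquiv φ), Nat.card_sigma,
    ← Finset.sum_coe_sort T]
  refine Finset.sum_congr rfl fun y _ => ?_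
  split_ifs with h
  · rw [← card_isMatchingOn_fiber hx y.2 h]
    refine Nat.card_congr (Equiv.subtypeEquivRight fun f => ?_)
    simp [φ, Subtype.ext_iff]
  · have : IsEmpty {f // φ f = y} := ⟨fun ⟨f, hf⟩ => h (by
      rw [← hf]; exact (hmem f).2)⟩
    exact Nat.card_of_isEmpty

theorem even_card_of_matchCount_ne_zero (H : SimpleGraph α) (S : Finset α)
    (h : matchCount H S ≠ 0) : Even S.card := by
  classical
  induction S using Finset.strongInduction with
  | H S ih =>
    rcases S.eq_empty_or_nonempty with rfl | ⟨x, hx⟩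
    · simp
    rw [← Finset.insert_erase hx, matchCount_insert H (Finset.notMem_erase x S)] at h
    obtain ⟨y, hy, hne⟩ := Finset.exists_ne_zero_of_sum_ne_zero h
    have hne' : matchCount H ((S.erase x).erase y) ≠ 0 := fun h0 => hne (by simp [h0])
    have hlt : (S.erase x).erase y ⊂ S :=
      (Finset.erase_subset _ _).trans_ssubset (Finset.erase_ssubset hx)
    have h2 := ih _ hlt hne'
    have c1 := Finset.card_erase_add_one hx
    have c2 := Finset.card_erase_add_one hy
    rw [← c1, ← c2, add_assoc]
    exact h2.add (by decide)

end Matchings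

theorem numDimers_eq_card_involutions {W : Type} (H : SimpleGraph W) :
    numDimers H = Nat.card {f : W → W // ∀ w, f (f w) = w ∧ H.Adj w (f w)} := by
  refine Nat.card_congr (Equiv.symm
    { toFun := fun f => ⟨⟨Set.univ, fun a b => f.1 a = b, ?_, fun _ => trivial, ⟨?_⟩⟩, ?_⟩
      invFun := fun M => ⟨fun w => (SimpleGraph.Subgraph.isPerfectMatching_iff.1 M.2 w).choose, ?_⟩
      left_inv := ?_
      right_inv := ?_ })
  · rintro a b rfl
    exact (f.2 a).2
  · rintro a b rfl
    exact (f.2 a).1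
  · rw [SimpleGraph.Subgraph.isPerfectMatching_iff]
    exact fun w => ⟨f.1 w, rfl, fun y hy => Eq.symm hy⟩
  · intro w
    have h := fun w => (SimpleGraph.Subgraph.isPerfectMatching_iff.1 M.2 w).choose_spec
    exact ⟨((h _).2 w (h w).1.symm).symm, (h w).1.adj_sub⟩
  · rintro ⟨f, hf⟩
    ext w
    dsimp only
    generalize_proofs h
    exact Eq.symm h.choose_spec.1
  · rintro ⟨M, hM⟩
    ext a b
    · simp [hM.2 a]
    · have h := (SimpleGraph.Subgraph.isPerfectMatching_iff.1 hM a).choose_spec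
      exact ⟨fun e => e ▸ h.1, fun e => (h.2 b e).symm⟩

/-- Perfect matchings of a graph `H'` are the matchings of `H` on `S` when `e` identifies `H'` with
the subgraph of `H` induced on `S`. -/
theorem numDimers_eq_matchCount {W : Type} {α : Type*} {H' : SimpleGraph W} {H : SimpleGraph α}
    {S : Finset α} {e : W → α} (he : Function.Injective e)
    (hadj : ∀ a b, H'.Adj a b ↔ H.Adj (e a) (e b)) (hS : ∀ x, x ∈ S ↔ ∃ w, e w = x) :
    numDimers H' = matchCount H S := by
  rw [numDimers_eq_card_involutions, matchCount]
  refine Nat.card_eq_of_bijective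
    (fun f => ⟨Function.extend e (e ∘ f.1) id, ?_, ?_⟩) ⟨?_, ?_⟩
  · intro x hx
    obtain ⟨w, rfl⟩ := (hS x).1 hx
    rw [he.extend_apply, Function.comp_apply, he.extend_apply, Function.comp_apply, (f.2 w).1,
      ← hadj]
    exact ⟨(hS _).2 ⟨_, rfl⟩, rfl, (f.2 w).2⟩
  · intro x hx
    rw [Function.extend_apply' _ _ _ (fun h => hx ((hS x).2 h))]
    rfl
  · intro f g hfg
    ext w
    have := congrFun (congrArg Subtype.val hfg) (e w)
    simp only [he.extend_apply, Function.comp_apply] at this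
    exact he this
  · rintro ⟨f, hf⟩
    have h : ∀ w, ∃ w', e w' = f (e w) := fun w => (hS _).1 (hf.1 _ ((hS _).2 ⟨w, rfl⟩)).1
    choose g hg using h
    refine ⟨⟨g, fun w => ⟨he ?_, ?_⟩⟩, ?_⟩
    · rw [hg, hg, (hf.1 _ ((hS _).2 ⟨w, rfl⟩)).2.1]
    · rw [hadj, hg]
      exact (hf.1 _ ((hS _).2 ⟨w, rfl⟩)).2.2
    · ext x
      simp only
      by_cases hx : ∃ w, e w = x
      · obtain ⟨w, rfl⟩ := hx
        rw [he.extend_apply, Function.comp_apply, hg]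
      · rw [Function.extend_apply' _ _ _ hx, hf.2 x (fun h => hx ((hS x).1 h))]
        rfl


/-! ### The lattice and its lexicographic order -/

/-- A lattice point, ordered lexicographically by column `col` and then by height `ht`. (The order
of `ℕ × ℕ` in Mathlib is the componentwise one, which is not linear.) -/
@[ext]
structure Site where
  col : ℕ
  ht : ℕ

namespace Site

instance : LinearOrder Site :=
  LinearOrder.lift' (fun x => toLex (x.col, x.ht)) fun x y h => by
    have h' := toLex.injective h
    rw [Prod.mk.injEq] at h'
    exact Site.ext h'.1 h'.2

theorem lt_iff {x y : Site} : x < y ↔ x.col < y.col ∨ x.col = y.col ∧ x.ht < y.ht :=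
  Prod.Lex.lt_iff (x := toLex (x.col, x.ht)) (y := toLex (y.col, y.ht))

/-- An edge of the infinite lattice, directed up, to the right, or up along the diagonal. -/
def Step (x y : Site) : Prop :=
  (y.col = x.col ∧ y.ht = x.ht + 1) ∨
  (y.col = x.col + 1 ∧ y.ht = x.ht ∧ (x.col + x.ht) % 2 = 1) ∨
  (x.ht = x.col ∧ y.col = x.col + 1 ∧ y.ht = x.ht + 1)

theorem Step.lt {x y : Site} (h : Step x y) : x < y := by
  rw [lt_iff]
  unfold Step at h
  omega

/-- The infinite lattice; the graphs `G_n` are induced subgraphs of it. -/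
def lattice : SimpleGraph Site where
  Adj x y := Step x y ∨ Step y x
  symm := ⟨fun _ _ h => h.symm⟩
  loopless := ⟨fun _ h => lt_irrefl _ (h.elim Step.lt Step.lt)⟩

open Classical in
/-- The antisymmetric weight that is `1` on every edge directed by `Step`. -/
noncomputable def weight (x y : Site) : ℚ := if Step x y then 1 else if Step y x then -1 else 0

theorem weight_antisymm (x y : Site) : weight x y = -weight y x := by
  by_cases h1 : Step x y
  · have h2 : ¬ Step y x := fun h2 => (h1.lt.trans h2.lt).false
    simp [weight, h1, h2]
  · by_cases h2 : Step y x <;> simp [weight, h1, h2]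

theorem weight_of_lt {x y : Site} (h : x < y) :
    weight x y = open Classical in if lattice.Adj x y then 1 else 0 := by
  have h2 : ¬ Step y x := fun h2 => (h.trans h2.lt).false
  by_cases h1 : Step x y <;> simp [weight, lattice, h1, h2]

/-! ### All matchings have the same sign -/

/-- `S` is what may be left of the vertex set `F` when vertices are removed in matched pairs, the
least one with its partner, and column `c` has been reached: the columns before `c` are used up,
those after `c + 1` are intact, and a vertex missing from column `c + 1` is not higher than any
vertex that remains in column `c`. -/
structure IsFrontier (F S : Finset Site) (c : ℕ) : Prop where
  subset : S ⊆ F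
  le_col : ∀ z ∈ S, c ≤ z.col
  mem_of_lt : ∀ z ∈ F, c + 1 < z.col → z ∈ S
  ht_le : ∀ z ∈ F, z.col = c + 1 → z ∉ S → ∀ x ∈ S, x.col = c → z.ht ≤ x.ht

theorem IsFrontier.mono {F S : Finset Site} {c c' : ℕ} (h : IsFrontier F S c) (hcc : c < c')
    (hS : ∀ z ∈ S, c' ≤ z.col) : IsFrontier F S c' where
  subset := h.subset
  le_col := hS
  mem_of_lt z hz hz' := h.mem_of_lt z hz (by omega)
  ht_le z hz hz' hzS := absurd (h.mem_of_lt z hz (by omega)) hzS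

theorem IsFrontier.erase {F T : Finset Site} {x y : Site}
    (h : IsFrontier F (insert x T) x.col) (hxT : ∀ z ∈ T, x < z) (hy : y ∈ T)
    (hxy : Step x y) : IsFrontier F (T.erase y) x.col where
  subset := ((Finset.erase_subset _ _).trans (Finset.subset_insert _ _)).trans h.subset
  le_col z hz := h.le_col z (Finset.mem_insert_of_mem (Finset.mem_of_mem_erase hz))
  mem_of_lt z hz hz' := by
    have h1 := h.mem_of_lt z hz hz'
    rcases Finset.mem_insert.1 h1 with rfl | h1
    · omega
    · refine Finset.mem_erase.2 ⟨?_, h1⟩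
      rintro rfl
      unfold Step at hxy
      omega
  ht_le z hz hzc hzS w hw hwc := by
    obtain ⟨hwy, hwT⟩ := Finset.mem_erase.1 hw
    have h1 := hxT w hwT
    rw [lt_iff] at h1
    by_cases hzy : z = y
    · subst hzy
      unfold Step at hxy
      omega
    · have h2 := h.ht_le z hz hzc (fun h3 => ?_) x (Finset.mem_insert_self _ _) rfl
      · omega
      · rcases Finset.mem_insert.1 h3 with rfl | h3
        · omega
        · exact hzS (Finset.mem_erase.2 ⟨hzy, h3⟩)

theorem neg_one_pow_transfer {a b a' e e' : ℕ} {p q : ℚ} (h : (-1) ^ a' * p = (-1) ^ e' * q)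
    (hpar : (a + b + a' + e + e') % 2 = 0) : (-1) ^ a * ((-1) ^ b * 1 * p) = (-1) ^ e * q := by
  rcases neg_one_pow_eq_or ℚ a' with h1 | h1 <;> rcases neg_one_pow_eq_or ℚ e' with h2 | h2 <;>
  rcases neg_one_pow_eq_or ℚ a with h3 | h3 <;> rcases neg_one_pow_eq_or ℚ b with h4 | h4 <;>
  rcases neg_one_pow_eq_or ℚ e with h5 | h5 <;>
  · have h0 : (-1 : ℚ) ^ (a + b + a' + e + e') = 1 :=
      Even.neg_one_pow (Nat.even_iff.2 hpar)
    simp only [pow_add, h1, h2, h3, h4, h5] at h h0 ⊢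
    linarith

/-- The sign bookkeeping of one removal step. The summand `(T.filter (· < y)).card` is the exponent
in the expansion of the Pfaffian, the products are the exponents `s * t` before and after the step,
and `j` is the column whose first vertex may be absent from `F`. -/
theorem step_parity {F T : Finset Site} {x y : Site} {j : ℕ}
    (h : IsFrontier F (insert x T) x.col) (hdiag : ∀ z ∈ F, z.col ≤ z.ht)
    (hpar : ∀ z ∈ F, 1 ≤ z.col → (z.col + z.ht) % 2 = 0 →
      (F.filter fun w => w.col = z.col ∧ w.ht < z.ht).card % 2 = if z.col = j then 1 else 0)
    (hxT : ∀ z ∈ T, x < z) (hy : y ∈ T) (hxy : Step x y) :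
    (((insert x T).filter fun z => z.col < j).card + (T.filter (· < y)).card +
      ((T.erase y).filter fun z => z.col < j).card +
      ((insert x T).filter fun z => z.col = x.col).card *
        (F.filter fun z => z.col = x.col + 1 ∧ z ∉ insert x T).card +
      ((T.erase y).filter fun z => z.col = x.col).card *
        (F.filter fun z => z.col = x.col + 1 ∧ z ∉ T.erase y).card) % 2 = 0 := by
  have hxT' : x ∉ T := fun h => lt_irrefl _ (hxT x h)
  have hyF : y ∈ F := h.subset (Finset.mem_insert_of_mem hy)
  have hxF : x ∈ F := h.subset (Finset.mem_insert_self _ _)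
  have hxd := hdiag x hxF
  have hins : ∀ (p : Site → Prop) [DecidablePred p], ((insert x T).filter p).card =
      (T.filter p).card + if p x then 1 else 0 := by
    intro p _
    rw [Finset.filter_insert]
    split_ifs
    · rw [Finset.card_insert_of_notMem (by simp [hxT'])]
    · rfl
  have hers : ∀ (p : Site → Prop) [DecidablePred p], (T.filter p).card =
      ((T.erase y).filter p).card + if p y then 1 else 0 := by
    intro p _
    conv_lhs => rw [← Finset.insert_erase hy]
    rw [Finset.filter_insert]
    split_ifs
    · rw [Finset.card_insert_of_notMem (by simp)]
    · rfl
  rw [hins, hers (fun z => z.col < j), hins, hers (fun z => z.col = x.col)]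
  by_cases hcol : y.col = x.col
  · have hyx : y.ht = x.ht + 1 := by unfold Step at hxy; omega
    -- `y` lies directly above `x`, so nothing lies between them.
    have h0 : T.filter (· < y) = ∅ := by
      rw [Finset.filter_eq_empty_iff]
      intro z hz
      have := hxT z hz
      rw [lt_iff] at this ⊢
      omega
    have h1 : (F.filter fun z => z.col = x.col + 1 ∧ z ∉ T.erase y) =
        F.filter fun z => z.col = x.col + 1 ∧ z ∉ insert x T := by
      refine Finset.filter_congr fun z _ => and_congr_right fun hz => ?_
      have hzx : z ≠ x := by rintro rfl; omega
      have hzy : z ≠ y := by rintro rfl; omega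
      simp [hzx, hzy]
    rw [h0, h1, hcol, Finset.card_empty, if_pos rfl]
    generalize ((T.erase y).filter fun z => z.col < j).card = B
    generalize ((T.erase y).filter fun z => z.col = x.col).card = s
    generalize (F.filter fun z => z.col = x.col + 1 ∧ z ∉ insert x T).card = t
    have : (s + 1 + 1) * t = s * t + 2 * t := by ring
    rw [this]
    split_ifs <;> omega
  · have hyc : y.col = x.col + 1 := by unfold Step at hxy; omega
    have hyh : (y.col + y.ht) % 2 = 0 ∧ x.ht ≤ y.ht := by unfold Step at hxy; omega
    -- `y` lies in the next column: between `x` and `y` are the rest of the column of `x` and what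
    -- remains of the next column below `y`. The part that is missing there all lies below `y`.
    have h0 : (T.filter (· < y)).card = ((T.erase y).filter fun z => z.col = x.col).card +
        ((insert x T).filter fun z => z.col = y.col ∧ z.ht < y.ht).card := by
      rw [hins, if_neg (by omega), hers (· < y), if_neg (lt_irrefl y), add_zero, add_zero,
        hers (fun z => z.col = y.col ∧ z.ht < y.ht), if_neg (by omega), add_zero,
        ← Finset.card_union_of_disjoint]
      · congr 1
        ext z
        simp only [Finset.mem_filter, Finset.mem_union, ← and_or_left, and_congr_right_iff]
        intro hz
        have := hxT z (Finset.mem_of_mem_erase hz)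
        rw [lt_iff] at this ⊢
        omega
      · rw [Finset.disjoint_filter]
        omega
    have h1 : (F.filter fun w => w.col = y.col ∧ w.ht < y.ht).card =
        ((insert x T).filter fun z => z.col = y.col ∧ z.ht < y.ht).card +
        (F.filter fun z => z.col = x.col + 1 ∧ z ∉ insert x T).card := by
      rw [← Finset.card_union_of_disjoint]
      · congr 1
        ext z
        simp only [Finset.mem_filter, Finset.mem_union]
        constructor
        · rintro ⟨hz, h1⟩
          by_cases hzS : z ∈ insert x T
          · exact Or.inl ⟨hzS, h1⟩
          · exact Or.inr ⟨hz, by omega, hzS⟩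
        · rintro (⟨hz, h1⟩ | ⟨hz, h1, hzS⟩)
          · exact ⟨h.subset hz, h1⟩
          · have h2 := h.ht_le z hz h1 hzS x (Finset.mem_insert_self _ _) rfl
            have h3 : z.ht ≠ y.ht := fun h3 => hzS (by
              rw [Site.ext (h1.trans hyc.symm) h3]
              exact Finset.mem_insert_of_mem hy)
            exact ⟨hz, by omega⟩
      · rw [Finset.disjoint_left]
        intro z hz hz'
        exact (Finset.mem_filter.1 hz').2.2 (Finset.mem_filter.1 hz).1
    have h2 : (F.filter fun z => z.col = x.col + 1 ∧ z ∉ T.erase y).card =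
        (F.filter fun z => z.col = x.col + 1 ∧ z ∉ insert x T).card + 1 := by
      rw [← Finset.card_insert_of_notMem (a := y)]
      · congr 1
        ext z
        by_cases hzy : z = y
        · subst hzy
          simp [hyF, hyc]
        · simp only [Finset.mem_filter, Finset.mem_insert, hzy, false_or, Finset.mem_erase]
          refine and_congr_right fun _ => and_congr_right fun hz => ?_
          have hzx : z ≠ x := by rintro rfl; omega
          simp [hzx, hzy]
      · simp [hy]
    have h3 := hpar y hyF (by omega) hyh.1
    rw [h2, h0, if_pos rfl, if_neg hcol]
    rw [h1] at h3
    rw [hyc] at h3 ⊢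
    revert h3
    generalize ((T.erase y).filter fun z => z.col < j).card = B
    generalize ((T.erase y).filter fun z => z.col = x.col).card = s
    generalize (F.filter fun z => z.col = x.col + 1 ∧ z ∉ insert x T).card = t
    generalize ((insert x T).filter fun z => z.col = x.col + 1 ∧ z.ht < y.ht).card = q
    intro h3
    have e1 : (s + 0 + 1) * t = s * t + t := by ring
    have e2 : s * (t + 1) = s * t + s := by ring
    rw [e1, e2]
    split_ifs at h3 ⊢ <;> omega

/-- All perfect matchings of `S` contribute to the Pfaffian with the same sign. The hypothesis
`hpar` concerns the vertices of `F` that may have a neighbour on their left: the number of vertices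
below such a vertex in its column is even, except in column `j`, where the first vertex is absent.
The extra sign on the left of the equation accounts for the absent vertex. -/
theorem pf_eq_matchCount {F : Finset Site} {j : ℕ} (hdiag : ∀ z ∈ F, z.col ≤ z.ht)
    (hpar : ∀ z ∈ F, 1 ≤ z.col → (z.col + z.ht) % 2 = 0 →
      (F.filter fun w => w.col = z.col ∧ w.ht < z.ht).card % 2 = if z.col = j then 1 else 0)
    (S : Finset Site) (c : ℕ) (h : IsFrontier F S c) :
    (-1) ^ (S.filter fun z => z.col < j).card * Pfaffian.pf weight_antisymm S =
      (-1) ^ ((S.filter fun z => z.col = c).card *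
        (F.filter fun z => z.col = c + 1 ∧ z ∉ S).card) * (matchCount lattice S : ℚ) := by
  classical
  induction hm : S.card using Nat.strong_induction_on generalizing S c with
  | _ m ih =>
  rcases S.eq_empty_or_nonempty with rfl | hne
  · simp [Pfaffian.pf_empty, matchCount_empty]
  obtain ⟨x, T, hxT, rfl⟩ : ∃ x T, (∀ z ∈ T, x < z) ∧ S = insert x T :=
    ⟨S.min' hne, S.erase (S.min' hne), fun z hz => Finset.min'_lt_of_mem_erase_min' _ _ hz,
      (Finset.insert_erase (S.min'_mem hne)).symm⟩
  have hxT' : x ∉ T := fun h => lt_irrefl _ (hxT x h)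
  have main : ∀ h : IsFrontier F (insert x T) x.col,
      (-1) ^ ((insert x T).filter fun z => z.col < j).card *
        Pfaffian.pf weight_antisymm (insert x T) =
      (-1) ^ (((insert x T).filter fun z => z.col = x.col).card *
        (F.filter fun z => z.col = x.col + 1 ∧ z ∉ insert x T).card) *
        (matchCount lattice (insert x T) : ℚ) := by
    intro h
    rw [Pfaffian.pf_insert _ hxT, matchCount_insert _ hxT', Nat.cast_sum, Finset.mul_sum,
      Finset.mul_sum]
    refine Finset.sum_congr rfl fun y hy => ?_
    rw [weight_of_lt (hxT y hy)]
    split_ifs with hadj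
    · have hxy : Step x y := hadj.resolve_right fun h2 => ((hxT y hy).trans h2.lt).false
      have hlt : (T.erase y).card < m := by
        rw [← hm, Finset.card_insert_of_notMem hxT']
        exact (Finset.card_erase_le).trans_lt (Nat.lt_succ_self _)
      exact neg_one_pow_transfer (ih _ hlt _ _ (h.erase hxT hy hxy) rfl)
        (step_parity h hdiag hpar hxT hy hxy)
    · simp
  have hle : c ≤ x.col := h.le_col x (Finset.mem_insert_self _ _)
  -- If column `c` is used up, then both for `c` and for the
  -- column of the least vertex the sign is `1`.
  rcases hle.eq_or_lt with rfl | hlt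
  · exact main h
  · have hx_le : ∀ z ∈ insert x T, x.col ≤ z.col := by
      intro z hz
      rcases Finset.mem_insert.1 hz with rfl | hz
      · exact le_rfl
      · have := lt_iff.1 (hxT z hz)
        omega
    have h' := h.mono hlt hx_le
    rw [main h']
    have e1 : ((insert x T).filter fun z => z.col = c) = ∅ := by
      rw [Finset.filter_eq_empty_iff]
      intro z hz
      have := hx_le z hz
      omega
    have e2 : (F.filter fun z => z.col = x.col + 1 ∧ z ∉ insert x T) = ∅ := by
      rw [Finset.filter_eq_empty_iff]
      rintro z hz ⟨h1, h2⟩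
      exact h2 (h.mem_of_lt z hz (by omega))
    rw [e1, e2]
    simp

end Site


/-! ### The graph `G_n` inside the lattice -/

open Site Pfaffian

/-- The lattice point with the given coordinates. -/
def site (p : ℕ × ℕ) : Site := ⟨p.1, p.2⟩

theorem site_injective : Function.Injective site := fun p q h => by
  simp only [site, Site.mk.injEq] at h
  exact Prod.ext h.1 h.2

/-- The vertices of `G_n` as lattice points. -/
def sites (n : ℕ) : Finset Site := (vertexSet n).image site

theorem mem_vertexSet {n : ℕ} {p : ℕ × ℕ} :
    p ∈ vertexSet n ↔ p.1 ≤ 2 * n ∧ p.2 ≤ 2 * n + 1 ∧ p.1 ≤ p.2 ∧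
      ¬ (n % 2 = 1 ∧ p.1 = 2 * n ∧ p.2 = 2 * n + 1) := by
  simp only [vertexSet, Finset.mem_filter, Finset.mem_product, Finset.mem_range, Prod.ext_iff,
    Nat.odd_iff]
  omega

theorem site_mem_sites {n : ℕ} {p : ℕ × ℕ} : site p ∈ sites n ↔ p ∈ vertexSet n := by
  rw [sites, Finset.mem_image]
  exact ⟨fun ⟨q, hq, h⟩ => site_injective h ▸ hq, fun h => ⟨p, h, rfl⟩⟩

theorem mem_sites {n : ℕ} {z : Site} :
    z ∈ sites n ↔ z.col ≤ 2 * n ∧ z.ht ≤ 2 * n + 1 ∧ z.col ≤ z.ht ∧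
      ¬ (n % 2 = 1 ∧ z.col = 2 * n ∧ z.ht = 2 * n + 1) :=
  (site_mem_sites (p := (z.col, z.ht))).trans mem_vertexSet

theorem edgeRel_iff_step {n : ℕ} {p q : ℕ × ℕ} (hp : p ∈ vertexSet n) (hq : q ∈ vertexSet n) :
    edgeRel n p q ↔ Step (site p) (site q) := by
  rw [mem_vertexSet] at hp hq
  simp only [edgeRel, Step, site, Prod.ext_iff]
  omega

theorem adj_iff_lattice {n : ℕ} (a b : Vertex n) :
    (G n).Adj a b ↔ lattice.Adj (site a.1) (site b.1) := by
  rw [G, SimpleGraph.fromRel_adj, edgeRel_iff_step a.2 b.2, edgeRel_iff_step b.2 a.2]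
  refine and_iff_right_of_imp ?_
  rintro h rfl
  exact lattice.loopless.irrefl _ h

theorem Z_eq (n : ℕ) : Z n = matchCount lattice (sites n) := by
  refine numDimers_eq_matchCount (e := fun a : Vertex n => site a.1)
    (fun a b h => Subtype.ext (site_injective h)) adj_iff_lattice fun x => ?_
  simp [sites]

theorem ZRemove_eq (n : ℕ) (x y : Vertex n) :
    ZRemove n {x, y} = matchCount lattice (((sites n).erase (site y.1)).erase (site x.1)) := by
  refine numDimers_eq_matchCount (e := fun a : ({x, y}ᶜ : Set (Vertex n)) => site a.1.1)
    (fun a b h => Subtype.ext (Subtype.ext (site_injective h)))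
    (fun a b => adj_iff_lattice a.1 b.1) fun z => ?_
  simp only [Finset.mem_erase, sites, Finset.mem_image]
  constructor
  · rintro ⟨h1, h2, p, hp, rfl⟩
    refine ⟨⟨⟨p, hp⟩, ?_⟩, rfl⟩
    rintro (h | h)
    · exact h1 (by rw [← h])
    · exact h2 (by rw [← (show _ = y from h)])
  · rintro ⟨⟨⟨p, hp⟩, h⟩, rfl⟩
    refine ⟨fun h1 => h (Or.inl ?_), fun h1 => h (Or.inr ?_), p, hp, rfl⟩
    · exact Subtype.ext (site_injective h1)
    · exact Subtype.ext (site_injective h1)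

theorem card_below {n : ℕ} {z : Site} (hz : z ∈ sites n) :
    ((sites n).filter fun w => w.col = z.col ∧ w.ht < z.ht).card = z.ht - z.col := by
  rw [← Nat.card_Ico, eq_comm]
  refine Finset.card_bij (fun h _ => ⟨z.col, h⟩) ?_ ?_ ?_
  · intro h hh
    rw [Finset.mem_Ico] at hh
    rw [mem_sites] at hz
    refine Finset.mem_filter.2 ⟨mem_sites.2 ?_, rfl, hh.2⟩
    dsimp only
    omega
  · intro a _ b _ h
    simpa using h
  · intro w hw
    simp only [Finset.mem_filter, mem_sites] at hw
    exact ⟨w.ht, Finset.mem_Ico.2 (by omega), Site.ext hw.2.1.symm rfl⟩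

theorem isFrontier_self (F : Finset Site) : IsFrontier F F 0 where
  subset := subset_rfl
  le_col _ _ := Nat.zero_le _
  mem_of_lt _ hz _ := hz
  ht_le _ hz _ hz' := absurd hz hz'

theorem pf_eq_matchCount_self {F : Finset Site} {j : ℕ} (hdiag : ∀ z ∈ F, z.col ≤ z.ht)
    (hpar : ∀ z ∈ F, 1 ≤ z.col → (z.col + z.ht) % 2 = 0 →
      (F.filter fun w => w.col = z.col ∧ w.ht < z.ht).card % 2 = if z.col = j then 1 else 0) :
    (-1) ^ (F.filter fun z => z.col < j).card * pf weight_antisymm F =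
      (matchCount lattice F : ℚ) := by
  rw [pf_eq_matchCount hdiag hpar F 0 (isFrontier_self F)]
  have : (F.filter fun z => z.col = 0 + 1 ∧ z ∉ F) = ∅ := by
    rw [Finset.filter_eq_empty_iff]
    exact fun z hz h => h.2 hz
  simp [this]

/-! ### Pfaffians and dimer counts -/

theorem pf_sites (n : ℕ) : pf weight_antisymm (sites n) = (Z n : ℚ) := by
  rw [Z_eq, ← pf_eq_matchCount_self (j := 0)]
  · simp
  · exact fun z hz => (mem_sites.1 hz).2.2.1
  · intro z hz h1 h2
    rw [card_below hz]
    rw [mem_sites] at hz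
    rw [if_neg (by omega)]
    omega

theorem pf_sites_erase (n : ℕ) (j : Fin (2 * n + 1)) :
    pf weight_antisymm (((sites n).erase (site (b n).1)).erase (site (diag n j).1)) =
      (-1) ^ ((((sites n).erase (site (b n).1)).erase (site (diag n j).1)).filter
        fun z => z.col < (j : ℕ)).card * (ZRemove n {diag n j, b n} : ℚ) := by
  have h := pf_eq_matchCount_self
    (F := ((sites n).erase (site (b n).1)).erase (site (diag n j).1)) (j := j) ?_ ?_
  · rw [ZRemove_eq, ← h, ← mul_assoc, ← mul_pow]
    simp
  · intro z hz
    exact (mem_sites.1 (Finset.mem_of_mem_erase (Finset.mem_of_mem_erase hz))).2.2.1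
  · intro z hz h1 h2
    obtain ⟨hzj, hz⟩ := Finset.mem_erase.1 hz
    obtain ⟨-, hz⟩ := Finset.mem_erase.1 hz
    rw [Finset.filter_erase, Finset.filter_erase]
    have hc := card_below hz
    rw [mem_sites] at hz
    have hzj' : ¬ (z.col = j ∧ z.ht = j) := fun h => hzj (Site.ext h.1 h.2)
    rw [Finset.erase_eq_of_notMem (a := site (b n).1)]
    · split_ifs with h3
      · rw [Finset.card_erase_of_mem, hc]
        · omega
        · refine Finset.mem_filter.2 ⟨site_mem_sites.2 (diag_mem n j), ?_⟩
          simp only [diag, site]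
          omega
      · rw [Finset.erase_eq_of_notMem, hc]
        · omega
        · simp only [Finset.mem_filter, diag, site]
          omega
    · simp only [Finset.mem_filter, b, site]
      omega

/-! ### A perfect matching of `G_n` -/

section ExplicitMatching

/-- The partner of a vertex in an explicit perfect matching of `G_n`. A column has an even number of
vertices if its index is even, and an odd number otherwise. The diagonal vertices of the columns
`4i + 1` and `4i + 2` are matched to each other, and so are the top vertices of the columns `4i + 2`
and `4i + 3`; in every column an even number of consecutive vertices is left, which are matched
vertically. For odd `n` the last column is the single vertex `(2n, 2n)`. -/
def partner (n : ℕ) (x : Site) : Site :=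
  if x.col % 4 = 1 ∧ x.ht = x.col then ⟨x.col + 1, x.ht + 1⟩
  else if x.col % 4 = 2 ∧ x.ht = x.col then ⟨x.col - 1, x.ht - 1⟩
  else if x.col % 4 = 2 ∧ x.ht = 2 * n + 1 then ⟨x.col + 1, x.ht⟩
  else if x.col % 4 = 3 ∧ x.ht = 2 * n + 1 then ⟨x.col - 1, x.ht⟩
  else if (x.col + x.ht) % 2 = 0 ↔ x.col % 4 = 0 ∨ x.col % 4 = 3 then ⟨x.col, x.ht + 1⟩
  else ⟨x.col, x.ht - 1⟩

theorem partner_cases (n : ℕ) (x : Site) :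
    (x.col % 4 = 1 ∧ x.ht = x.col ∧
      (partner n x).col = x.col + 1 ∧ (partner n x).ht = x.ht + 1) ∨
    (x.col % 4 = 2 ∧ x.ht = x.col ∧
      (partner n x).col = x.col - 1 ∧ (partner n x).ht = x.ht - 1) ∨
    (x.col % 4 = 2 ∧ x.ht ≠ x.col ∧ x.ht = 2 * n + 1 ∧
      (partner n x).col = x.col + 1 ∧ (partner n x).ht = x.ht) ∨
    (x.col % 4 = 3 ∧ x.ht = 2 * n + 1 ∧
      (partner n x).col = x.col - 1 ∧ (partner n x).ht = x.ht) ∨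
    ((x.ht = x.col → x.col % 4 ≠ 1 ∧ x.col % 4 ≠ 2) ∧
      (x.ht = 2 * n + 1 → x.col % 4 ≠ 2 ∧ x.col % 4 ≠ 3) ∧
      ((x.col + x.ht) % 2 = 0 ↔ x.col % 4 = 0 ∨ x.col % 4 = 3) ∧
      (partner n x).col = x.col ∧ (partner n x).ht = x.ht + 1) ∨
    ((x.ht = x.col → x.col % 4 ≠ 1 ∧ x.col % 4 ≠ 2) ∧
      (x.ht = 2 * n + 1 → x.col % 4 ≠ 2 ∧ x.col % 4 ≠ 3) ∧
      ¬ ((x.col + x.ht) % 2 = 0 ↔ x.col % 4 = 0 ∨ x.col % 4 = 3) ∧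
      (partner n x).col = x.col ∧ (partner n x).ht = x.ht - 1) := by
  unfold partner
  split_ifs with h1 h2 h3 h4 h5
  · exact Or.inl ⟨h1.1, h1.2, rfl, rfl⟩
  · exact Or.inr (Or.inl ⟨h2.1, h2.2, rfl, rfl⟩)
  · exact Or.inr (Or.inr (Or.inl ⟨h3.1, fun h => h2 ⟨h3.1, h⟩, h3.2, rfl, rfl⟩))
  · exact Or.inr (Or.inr (Or.inr (Or.inl ⟨h4.1, h4.2, rfl, rfl⟩)))
  · exact Or.inr (Or.inr (Or.inr (Or.inr (Or.inl
      ⟨fun h => ⟨fun h' => h1 ⟨h', h⟩, fun h' => h2 ⟨h', h⟩⟩,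
        fun h => ⟨fun h' => h3 ⟨h', h⟩, fun h' => h4 ⟨h', h⟩⟩, h5, rfl, rfl⟩))))
  · exact Or.inr (Or.inr (Or.inr (Or.inr (Or.inr
      ⟨fun h => ⟨fun h' => h1 ⟨h', h⟩, fun h' => h2 ⟨h', h⟩⟩,
        fun h => ⟨fun h' => h3 ⟨h', h⟩, fun h' => h4 ⟨h', h⟩⟩,
        h5, rfl, rfl⟩))))

theorem partner_mem {n : ℕ} {x : Site} (hx : x ∈ sites n) : partner n x ∈ sites n := by
  have h1 := partner_cases n x
  generalize partner n x = y at *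
  rw [mem_sites] at hx ⊢
  rcases h1 with h1 | h1 | h1 | h1 | h1 | h1 <;> refine ⟨?_, ?_, ?_, ?_⟩ <;> omega

theorem adj_partner {n : ℕ} {x : Site} (hx : x ∈ sites n) : lattice.Adj x (partner n x) := by
  have h1 := partner_cases n x
  generalize partner n x = y at *
  rw [mem_sites] at hx
  simp only [lattice, Step]
  rcases h1 with h1 | h1 | h1 | h1 | h1 | h1
  · exact Or.inl (Or.inr (Or.inr (by omega)))
  · exact Or.inr (Or.inr (Or.inr (by omega)))
  · exact Or.inl (Or.inr (Or.inl (by omega)))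
  · exact Or.inr (Or.inr (Or.inl (by omega)))
  · exact Or.inl (Or.inl (by omega))
  · exact Or.inr (Or.inl (by omega))

theorem partner_partner {n : ℕ} {x : Site} (hx : x ∈ sites n) :
    partner n (partner n x) = x := by
  have h1 := partner_cases n x
  have h2 := partner_cases n (partner n x)
  generalize partner n (partner n x) = z at *
  generalize partner n x = y at *
  rw [mem_sites] at hx
  obtain ⟨hx1, hx2, hx3, -⟩ := hx
  rcases h1 with h1 | h1 | h1 | h1 | h1 | h1 <;>
  rcases h2 with h2 | h2 | h2 | h2 | h2 | h2 <;>
  first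
  | (exfalso; omega)
  | (apply Site.ext <;> omega)

theorem Z_ne_zero (n : ℕ) : Z n ≠ 0 := by
  rw [Z_eq]
  exact matchCount_ne_zero fun x hx =>
    ⟨partner_mem hx, partner_partner hx, adj_partner hx⟩

end ExplicitMatching

/-! ### Comparison with the Kasteleyn matrix -/

section Gauge

/-- The diagonal signs that make all entries of the Kasteleyn matrix on edges directed by `Step`
equal to `1`. -/
def gauge (p : ℕ × ℕ) : ℚ := (-1) ^ (p.1 + (p.2 - p.1) / 2)

theorem gauge_mul_self (p : ℕ × ℕ) : gauge p * gauge p = 1 := by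
  rw [gauge, ← mul_pow]
  simp

theorem k_eq_one {p q : ℕ × ℕ}
    (h : (p.1 + p.2) % 2 = 0 ∧ p.2 = q.2 ∧ p.1 = q.1 + 1 ∨
      (p.1 + p.2) % 2 = 0 ∧ (q.2 = p.2 + 1 ∨ p.2 = q.2 + 1) ∧ p.1 = q.1 ∨
      p.1 = p.2 ∧ q.1 = q.2 ∧ p.1 = q.1 + 1) : k p q = 1 := by
  unfold k
  split_ifs with h1 h2 h3
  · rfl
  · rfl
  · rfl
  · exact absurd h (by tauto)

theorem k_eq_zero {p q : ℕ × ℕ}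
    (h1 : ¬ ((p.1 + p.2) % 2 = 0 ∧ p.2 = q.2 ∧ p.1 = q.1 + 1))
    (h2 : ¬ ((p.1 + p.2) % 2 = 0 ∧ (q.2 = p.2 + 1 ∨ p.2 = q.2 + 1) ∧ p.1 = q.1))
    (h3 : ¬ (p.1 = p.2 ∧ q.1 = q.2 ∧ p.1 = q.1 + 1)) : k p q = 0 := by
  rw [k, if_neg h1, if_neg h2, if_neg h3]

theorem k_sub_k_of_step {p q : ℕ × ℕ} (hp : p.1 ≤ p.2) (h : Step (site p) (site q)) :
    k p q - k q p = gauge p * gauge q := by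
  rw [gauge, gauge, ← pow_add]
  simp only [Step, site] at h
  by_cases hpar : (p.1 + p.2) % 2 = 0 ∧ p.1 = q.1
  · rw [k_eq_one (by omega), k_eq_zero (by omega) (by omega) (by omega),
      Even.neg_one_pow (Nat.even_iff.2 (by omega)), sub_zero]
  · rw [k_eq_zero (by omega) (by omega) (by omega), k_eq_one (by omega),
      Odd.neg_one_pow (Nat.odd_iff.2 (by omega)), zero_sub]

theorem k_eq_zero_of_not_step {p q : ℕ × ℕ} (hp : p.1 ≤ p.2) (hq : q.1 ≤ q.2)
    (h1 : ¬ Step (site p) (site q)) (h2 : ¬ Step (site q) (site p)) : k p q = 0 := by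
  simp only [Step, site] at h1 h2
  exact k_eq_zero (by omega) (by omega) (by omega)

theorem k_sub_k {p q : ℕ × ℕ} (hp : p.1 ≤ p.2) (hq : q.1 ≤ q.2) :
    k p q - k q p = gauge p * gauge q * weight (site p) (site q) := by
  by_cases h1 : Step (site p) (site q)
  · rw [k_sub_k_of_step hp h1, weight, if_pos h1, mul_one]
  · by_cases h2 : Step (site q) (site p)
    · rw [← neg_sub, k_sub_k_of_step hq h2, weight, if_neg h1, if_pos h2]
      ring
    · rw [k_eq_zero_of_not_step hp hq h1 h2, k_eq_zero_of_not_step hq hp h2 h1,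
        weight, if_neg h1, if_neg h2]
      simp

theorem K_apply {n : ℕ} (x y : Vertex n) :
    K n x y = gauge x.1 * gauge y.1 * weight (site x.1) (site y.1) :=
  k_sub_k (mem_vertexSet.1 x.2).2.2.1 (mem_vertexSet.1 y.2).2.2.1

end Gauge

/-! ### The inverse of the Kasteleyn matrix -/

section Inverse

/-- The inverse of `K n`: the adjugate formula with the gauge signs restored. -/
noncomputable def kInv (n : ℕ) : Matrix (Vertex n) (Vertex n) ℚ :=
  Matrix.of fun y x => if y = x then 0 else
    gauge y.1 * gauge x.1 * (-1) ^ ((sites n).filter (· < site x.1)).card *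
      ((-1) ^ (((sites n).erase (site x.1)).filter (· < site y.1)).card *
        pf weight_antisymm (((sites n).erase (site x.1)).erase (site y.1))) / (Z n : ℚ)

theorem K_mul_kInv (n : ℕ) : K n * kInv n = 1 := by
  ext x z
  have hZ : (Z n : ℚ) ≠ 0 := Nat.cast_ne_zero.2 (Z_ne_zero n)
  have key := sum_mul_pf_erase weight_antisymm (site_mem_sites.2 x.2) (site_mem_sites.2 z.2)
  rw [Matrix.mul_apply]
  have hsum : ∑ y, K n x y * kInv n y z =
      gauge x.1 * gauge z.1 * (-1) ^ ((sites n).filter (· < site z.1)).card / (Z n : ℚ) *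
      ∑ y ∈ (sites n).erase (site z.1), weight (site x.1) y *
        ((-1) ^ (((sites n).erase (site z.1)).filter (· < y)).card *
          pf weight_antisymm (((sites n).erase (site z.1)).erase y)) := by
    have himg : (sites n).erase (site z.1) =
        ((Finset.univ : Finset (Vertex n)).erase z).image fun y => site y.1 := by
      ext w
      simp only [sites, Finset.mem_erase, Finset.mem_image, Finset.mem_univ, and_true]
      constructor
      · rintro ⟨h1, p, hp, rfl⟩
        exact ⟨⟨p, hp⟩, fun h => h1 (by rw [← h]), rfl⟩
      · rintro ⟨a, h1, rfl⟩
        exact ⟨fun h => h1 (Subtype.ext (site_injective h)), a.1, a.2, rfl⟩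
    conv_rhs => rw [Finset.sum_congr himg fun _ _ => rfl]
    rw [Finset.sum_image fun a _ c _ h => Subtype.ext (site_injective h), Finset.mul_sum,
      ← Finset.add_sum_erase _ _ (Finset.mem_univ z)]
    have h0 : kInv n z z = 0 := by simp [kInv]
    rw [h0, mul_zero, zero_add]
    refine Finset.sum_congr rfl fun y hy => ?_
    rw [K_apply, kInv, Matrix.of_apply, if_neg (Finset.ne_of_mem_erase hy)]
    have := gauge_mul_self y.1
    linear_combination (gauge x.1 * gauge z.1 * weight (site x.1) (site y.1) *
      (-1) ^ ((sites n).filter (· < site z.1)).card *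
      ((-1) ^ (((sites n).erase (site z.1)).filter (· < site y.1)).card *
        pf weight_antisymm (((sites n).erase (site z.1)).erase (site y.1))) / (Z n : ℚ)) * this
  rw [hsum, key, Matrix.one_apply]
  by_cases hxz : x = z
  · subst hxz
    have h1 : (-1 : ℚ) ^ ((sites n).filter (· < site x.1)).card *
        (-1) ^ ((sites n).filter (· < site x.1)).card = 1 := by
      rw [← mul_pow]
      simp
    rw [if_pos rfl, if_pos rfl, pf_sites, div_mul_eq_mul_div, div_eq_one_iff_eq hZ]
    linear_combination (Z n : ℚ) * gauge x.1 * gauge x.1 * h1 + (Z n : ℚ) * gauge_mul_self x.1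
  · rw [if_neg hxz, if_neg fun h => hxz (Subtype.ext (site_injective h)), mul_zero]

theorem inv_K (n : ℕ) : (K n)⁻¹ = kInv n := Matrix.inv_eq_right_inv (K_mul_kInv n)

theorem isUnit_det_K (n : ℕ) : IsUnit (K n).det :=
  Matrix.isUnit_det_of_right_inverse (K_mul_kInv n)

theorem even_card_sites (n : ℕ) : Even (sites n).card :=
  even_card_of_matchCount_ne_zero lattice _ (Z_eq n ▸ Z_ne_zero n)

/-- An odd number of vertices is left. -/
theorem ZRemove_self (n : ℕ) (x : Vertex n) : ZRemove n {x, x} = 0 := by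
  rw [ZRemove_eq, Finset.erase_idem]
  by_contra h
  have h1 := even_card_of_matchCount_ne_zero _ _ h
  have h2 := even_card_sites n
  rw [← Finset.card_erase_add_one (site_mem_sites.2 x.2)] at h2
  exact absurd h1 (by simpa [Nat.even_add_one] using h2)

theorem lt_site_b {n : ℕ} {z : Site} (hz : z ∈ sites n) (hzb : z ≠ site (b n).1) :
    z < site (b n).1 := by
  rw [mem_sites] at hz
  have h : ¬ (z.col = 2 * n ∧ z.ht = 2 * n + 1 - n % 2) := fun h => hzb (Site.ext h.1 h.2)
  rw [lt_iff]
  simp only [site, b]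
  omega

theorem gauge_diag {n : ℕ} (j : Fin (2 * n + 1)) : gauge (diag n j).1 = (-1) ^ (j : ℕ) := by
  simp [gauge, diag]

theorem gauge_b (n : ℕ) : gauge (b n).1 = 1 := by
  have : (2 * n + 1 - n % 2 - 2 * n) / 2 = 0 := by omega
  simp [gauge, b, this]

theorem inv_K_diag_b (n : ℕ) (j : Fin (2 * n + 1)) :
    (K n)⁻¹ (diag n j) (b n) =
      (-1) ^ ((j : ℕ) + 1) * ((ZRemove n {diag n j, b n} : ℚ) / (Z n : ℚ)) := by
  rw [inv_K, kInv, Matrix.of_apply]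
  split_ifs with h
  · rw [h, ZRemove_self]
    simp
  have hb : site (b n).1 ∈ sites n := site_mem_sites.2 (b n).2
  have h1 : (sites n).filter (· < site (b n).1) = (sites n).erase (site (b n).1) := by
    ext z
    rw [Finset.mem_filter, Finset.mem_erase]
    exact ⟨fun h => ⟨h.2.ne, h.1⟩, fun h => ⟨h.2, lt_site_b h.2 h.1⟩⟩
  have h2 : ((sites n).erase (site (b n).1)).filter (· < site (diag n j).1) =
      (((sites n).erase (site (b n).1)).erase (site (diag n j).1)).filter
        fun z => z.col < (j : ℕ) := by
    ext z
    simp only [Finset.mem_filter, Finset.mem_erase, lt_iff, mem_sites]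
    simp only [site, diag, ne_eq, Site.ext_iff]
    omega
  have h3 : Odd ((sites n).erase (site (b n).1)).card := by
    have := even_card_sites n
    rw [← Finset.card_erase_add_one hb] at this
    simpa [Nat.even_add_one] using this
  rw [h1, h2, pf_sites_erase, gauge_diag, gauge_b, h3.neg_one_pow]
  generalize ((((sites n).erase (site (b n).1)).erase (site (diag n j).1)).filter
    fun z => z.col < (j : ℕ)).card = m
  have h4 : (-1 : ℚ) ^ m * (-1) ^ m = 1 := by
    rw [← mul_pow]
    simp
  linear_combination (-(-1 : ℚ) ^ (j : ℕ) * (ZRemove n {diag n j, b n} : ℚ) / (Z n : ℚ)) * h4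

end Inverse


/-! ### The sum over the diagonal -/

section Sum

/-- The column of `b` in the inverse of `K n`, extended by zero to all points, so that rows of `K n`
at the boundary need no separate treatment. -/
noncomputable def column (n : ℕ) (p : ℕ × ℕ) : ℚ :=
  if h : p ∈ vertexSet n then (K n)⁻¹ ⟨p, h⟩ (b n) else 0

theorem column_of_notMem {n : ℕ} {p : ℕ × ℕ} (h : p ∉ vertexSet n) : column n p = 0 :=
  dif_neg h

theorem column_diag (n : ℕ) (j : Fin (2 * n + 1)) :
    column n ((j : ℕ), (j : ℕ)) = (K n)⁻¹ (diag n j) (b n) :=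
  dif_pos (diag_mem n j)

/-- The inverse of an antisymmetric matrix has zero diagonal. -/
theorem column_b (n : ℕ) : column n (b n).1 = 0 := by
  rw [column, dif_pos (b n).2, inv_K, kInv, Matrix.of_apply, if_pos rfl]

theorem sum_k_mul_column {n : ℕ} {p : ℕ × ℕ} (hp : p ∈ vertexSet n) :
    ∑ q ∈ vertexSet n, (k p q - k q p) * column n q = if p = (b n).1 then 1 else 0 := by
  have h := congrFun (congrFun (Matrix.mul_nonsing_inv (K n) (isUnit_det_K n)) ⟨p, hp⟩) (b n)
  rw [Matrix.mul_apply, Matrix.one_apply] at h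
  rw [← Finset.sum_coe_sort]
  refine (Finset.sum_congr rfl fun q _ => ?_).trans (h.trans ?_)
  · rw [column, dif_pos q.2]
    rfl
  · simp only [Subtype.ext_iff]

theorem sum_ite_mul_column {n : ℕ} {P : ℕ × ℕ → Prop} [DecidablePred P] {a : ℕ × ℕ}
    (hP : ∀ q, P q ↔ q = a) :
    ∑ q ∈ vertexSet n, (if P q then 1 else 0) * column n q = column n a := by
  simp only [hP, ite_mul, one_mul, zero_mul, Finset.sum_ite_eq']
  split_ifs with h
  · rfl
  · exact (column_of_notMem h).symm

theorem k_sub_k_diag {p q : ℕ × ℕ} (hp : p.2 = p.1) (hq : q.1 ≤ q.2) :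
    k p q - k q p = (if q.1 = p.1 ∧ q.2 = p.2 + 1 then 1 else 0) +
      (if q.1 + 1 = p.1 ∧ q.2 = p.2 then 1 else 0) +
      (if q.1 + 1 = p.1 ∧ q.2 + 1 = p.2 then 1 else 0) -
      (if q.1 = p.1 + 1 ∧ q.2 = p.2 + 1 then 1 else 0) := by
  by_cases h1 : (q.1 = p.1 ∧ q.2 = p.2 + 1) ∨ (q.1 + 1 = p.1 ∧ q.2 = p.2) ∨
      (q.1 + 1 = p.1 ∧ q.2 + 1 = p.2)
  · rw [k_eq_one (by omega), k_eq_zero (by omega) (by omega) (by omega)]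
    split_ifs <;> first | omega | norm_num
  · rw [k_eq_zero (by omega) (by omega) (by omega)]
    by_cases h2 : q.1 = p.1 + 1 ∧ q.2 = p.2 + 1
    · rw [k_eq_one (by omega)]
      split_ifs <;> first | omega | norm_num
    · rw [k_eq_zero (by omega) (by omega) (by omega)]
      split_ifs <;> first | omega | norm_num

theorem k_sub_k_upper {p q : ℕ × ℕ} (hp : p.2 = p.1 + 2) (hq : q.1 ≤ q.2) :
    k p q - k q p = (if q.1 = p.1 ∧ q.2 + 1 = p.2 then 1 else 0) +
      (if q.1 = p.1 ∧ q.2 = p.2 + 1 then 1 else 0) +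
      (if q.1 + 1 = p.1 ∧ q.2 = p.2 then 1 else 0) := by
  by_cases h1 : (q.1 = p.1 ∧ q.2 + 1 = p.2) ∨ (q.1 = p.1 ∧ q.2 = p.2 + 1) ∨
      (q.1 + 1 = p.1 ∧ q.2 = p.2)
  · rw [k_eq_one (by omega), k_eq_zero (by omega) (by omega) (by omega)]
    split_ifs <;> first | omega | norm_num
  · rw [k_eq_zero (by omega) (by omega) (by omega), k_eq_zero (by omega) (by omega) (by omega)]
    split_ifs <;> first | omega | norm_num

theorem sum_diag_row (n c : ℕ) :
    ∑ q ∈ vertexSet n, (k (c, c) q - k q (c, c)) * column n q =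
      column n (c, c + 1) + (if c = 0 then 0 else column n (c - 1, c)) +
      (if c = 0 then 0 else column n (c - 1, c - 1)) - column n (c + 1, c + 1) := by
  rw [Finset.sum_congr rfl fun q hq => by
    rw [k_sub_k_diag (p := (c, c)) rfl (mem_vertexSet.1 hq).2.2.1, sub_mul, add_mul, add_mul]]
  rw [Finset.sum_sub_distrib, Finset.sum_add_distrib, Finset.sum_add_distrib,
    sum_ite_mul_column (a := (c, c + 1)) fun q => by simp only [Prod.ext_iff],
    sum_ite_mul_column (P := fun q => q.1 = c + 1 ∧ q.2 = c + 1) (a := (c + 1, c + 1))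
      fun q => by simp only [Prod.ext_iff]]
  split_ifs with hc
  · subst hc
    simp
  · rw [sum_ite_mul_column (a := (c - 1, c)) fun q => by simp only [Prod.ext_iff]; omega,
      sum_ite_mul_column (a := (c - 1, c - 1)) fun q => by simp only [Prod.ext_iff]; omega]

theorem sum_upper_row (n c : ℕ) :
    ∑ q ∈ vertexSet n, (k (c, c + 2) q - k q (c, c + 2)) * column n q =
      column n (c, c + 1) + column n (c, c + 3) +
      (if c = 0 then 0 else column n (c - 1, c + 2)) := by
  rw [Finset.sum_congr rfl fun q hq => by
    rw [k_sub_k_upper (p := (c, c + 2)) rfl (mem_vertexSet.1 hq).2.2.1, add_mul, add_mul]]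
  rw [Finset.sum_add_distrib, Finset.sum_add_distrib,
    sum_ite_mul_column (a := (c, c + 1)) fun q => by simp only [Prod.ext_iff]; omega,
    sum_ite_mul_column (a := (c, c + 3)) fun q => by simp only [Prod.ext_iff]]
  split_ifs with hc
  · subst hc
    simp
  · rw [sum_ite_mul_column (a := (c - 1, c + 2)) fun q => by simp only [Prod.ext_iff]; omega]

/-- In the partial sums every off-diagonal entry of `column n` cancels, except for those next to the
last column. -/
theorem sum_rows_telescope (n m : ℕ) :
    ∑ c ∈ Finset.range (m + 1), (-1) ^ c *
      ((c + 1) * ∑ q ∈ vertexSet n, (k (c, c) q - k q (c, c)) * column n q +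
        ∑ q ∈ vertexSet n, (k (c, c + 2) q - k q (c, c + 2)) * column n q) =
    2 * ∑ c ∈ Finset.range (m + 1), (-1) ^ (c + 1) * column n (c, c) +
      (-1) ^ m * ((m + 2) * column n (m, m + 1) + column n (m, m + 3) +
        (m + 2) * column n (m, m) - (m + 1) * column n (m + 1, m + 1)) := by
  induction m with
  | zero =>
    rw [Finset.sum_range_one, Finset.sum_range_one, sum_diag_row, sum_upper_row]
    simp
    ring
  | succ m ih =>
    rw [Finset.sum_range_succ, ih, Finset.sum_range_succ _ (m + 1), sum_diag_row, sum_upper_row,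
      if_neg (Nat.succ_ne_zero m), if_neg (Nat.succ_ne_zero m), if_neg (Nat.succ_ne_zero m)]
    simp only [Nat.add_sub_cancel, Nat.cast_add, Nat.cast_one, pow_succ]
    ring

theorem column_corner_of_even {n : ℕ} (hn : n % 2 = 0) : column n (2 * n, 2 * n) = -1 := by
  have hb : ((b n).1 : ℕ × ℕ) = (2 * n, 2 * n + 1) := by simp [b, hn]
  have h := sum_k_mul_column (b n).2
  rw [if_pos rfl, hb] at h
  rw [← h, ← sum_ite_mul_column (P := (· = (2 * n, 2 * n))) fun q => Iff.rfl,
    ← Finset.sum_neg_distrib]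
  refine Finset.sum_congr rfl fun q hq => ?_
  rw [mem_vertexSet] at hq
  rw [k_eq_zero (by dsimp only; omega) (by dsimp only; omega) (by dsimp only; omega)]
  split_ifs with h1
  · subst h1
    rw [k_eq_one (by dsimp only; omega)]
    ring
  · rw [Prod.ext_iff] at h1
    rw [k_eq_zero (by dsimp only at *; omega) (by dsimp only at *; omega)
      (by dsimp only at *; omega)]
    ring

theorem sum_column_diag (n : ℕ) :
    ∑ c ∈ Finset.range (2 * n + 1), (-1) ^ (c + 1) * column n (c, c) =
      if Even n then (n : ℚ) + 1 else (n : ℚ) + 1 / 2 := by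
  have hT := sum_rows_telescope n (2 * n)
  have hp : column n (2 * n, 2 * n + 1) = 0 := by
    rcases Nat.mod_two_eq_zero_or_one n with hn | hn
    · have hb : ((b n).1 : ℕ × ℕ) = (2 * n, 2 * n + 1) := by simp [b, hn]
      rw [← hb, column_b]
    · exact column_of_notMem fun h => (mem_vertexSet.1 h).2.2.2 ⟨hn, rfl, rfl⟩
  have hq : column n (2 * n, 2 * n + 3) = 0 :=
    column_of_notMem fun h => by have := (mem_vertexSet.1 h).2.1; dsimp only at this; omega
  have hd : column n (2 * n + 1, 2 * n + 1) = 0 :=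
    column_of_notMem fun h => by have := (mem_vertexSet.1 h).1; dsimp only at this; omega
  have hu : ∀ c ∈ Finset.range (2 * n + 1),
      ∑ q ∈ vertexSet n, (k (c, c + 2) q - k q (c, c + 2)) * column n q = 0 := by
    intro c hc
    rw [Finset.mem_range] at hc
    rcases (Nat.lt_succ_iff.1 hc).eq_or_lt with rfl | hlt
    · rw [sum_upper_row, hp, hq, add_zero, zero_add]
      split_ifs with h0
      · rfl
      · exact column_of_notMem fun h => by
          have := (mem_vertexSet.1 h).2.1
          dsimp only at this
          omega
    · rw [sum_k_mul_column (mem_vertexSet.2 (by dsimp only; omega)), if_neg]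
      simp only [b, Prod.ext_iff]
      omega
  have hdiag : ∀ c ∈ Finset.range (2 * n + 1),
      ∑ q ∈ vertexSet n, (k (c, c) q - k q (c, c)) * column n q =
        if c = 2 * n then (if Even n then 0 else 1) else 0 := by
    intro c hc
    rw [Finset.mem_range] at hc
    rw [sum_k_mul_column (mem_vertexSet.2 (by dsimp only; omega))]
    simp only [b, Prod.ext_iff, Nat.even_iff]
    split_ifs <;> first | rfl | omega
  rw [Finset.sum_congr rfl fun c hc => by rw [hu c hc, hdiag c hc, add_zero], hp, hq, hd] at hT
  simp only [mul_ite, mul_zero, Finset.sum_ite_eq', Finset.mem_range, Nat.lt_succ_self, if_true,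
    mul_one, (even_two_mul n).neg_one_pow, one_mul, zero_add, sub_zero] at hT
  push_cast at hT
  split_ifs at hT ⊢ with hn
  · rw [column_corner_of_even (Nat.even_iff.1 hn)] at hT
    linarith
  · have hb : ((b n).1 : ℕ × ℕ) = (2 * n, 2 * n) := by
      simp [b, Nat.not_even_iff.1 hn]
    rw [← hb, column_b] at hT
    linarith

theorem g_eq (n : ℕ) (j : Fin (2 * n + 1)) :
    g n j = (ZRemove n {diag n j, b n} : ℚ) / (Z n : ℚ) := by
  rw [g, inv_K_diag_b, abs_mul, abs_pow, abs_neg, abs_one, one_pow, one_mul]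
  exact abs_of_nonneg (by positivity)

theorem g_eq_sign_mul (n : ℕ) (j : Fin (2 * n + 1)) :
    g n j = (-1) ^ ((j : ℕ) + 1) * (K n)⁻¹ (diag n j) (b n) := by
  rw [g_eq, inv_K_diag_b, ← mul_assoc, ← mul_pow]
  simp

end Sum

end TSSCPP

theorem theorem3p4 (n : ℕ) :
    IsUnit (TSSCPP.K n).det ∧ TSSCPP.Z n ≠ 0 ∧
    (∀ j : Fin (2 * n + 1),
      TSSCPP.g n j =
        (-1 : ℚ) ^ ((j : ℕ) + 1) * (TSSCPP.K n)⁻¹ (TSSCPP.diag n j) (TSSCPP.b n) ∧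
      TSSCPP.g n j =
        (TSSCPP.ZRemove n {TSSCPP.diag n j, TSSCPP.b n} : ℚ) / (TSSCPP.Z n : ℚ)) ∧
    ∑ j : Fin (2 * n + 1), TSSCPP.g n j =
      if Even n then (n : ℚ) + 1 else (n : ℚ) + 1 / 2 := by
  refine ⟨TSSCPP.isUnit_det_K n, TSSCPP.Z_ne_zero n,
    fun j => ⟨TSSCPP.g_eq_sign_mul n j, TSSCPP.g_eq n j⟩, ?_⟩
  rw [← TSSCPP.sum_column_diag, ← Fin.sum_univ_eq_sum_range
    (fun c => (-1) ^ (c + 1) * TSSCPP.column n (c, c))]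
  refine Finset.sum_congr rfl fun j _ => ?_
  rw [TSSCPP.g_eq_sign_mul, TSSCPP.column_diag]
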